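/- For $p\in\mathbb Z[x]$ let the height $\mathrm{ht}(p)$ be the largest absolute value of a coefficient of $p$. An irreducible factorization $p=h_1\cdots h_s$ in $\mathbb Z[x]$ is one with all $h_i$ irreducible in $\mathbb Z[x]$; its ratio is $\min_i \mathrm{ht}(h_i)/\mathrm{ht}(p)$. For $f=g_1g_2$ call an integer $k\ge 1$ suitable if $\mathrm{ht}(f(x)f(x^k))=\mathrm{ht}(f)^2$ and both $g_1(x^k)$ and $g_2(x^k)$ are irreducible in $\mathbb Z[x]$. (a) Let $f=g_1g_2$ be an irreducible factorization in $\mathbb Z[x]$ with $\mathrm{ht}(f)^2<\min(\mathrm{ht}(g_1),\mathrm{ht}(g_2))$. Then $\mathrm{ht}(f(x)f(x^k))=\mathrm{ht}(f)^2$ for every $k>\deg f$. If neither $g_1$ nor $g_2$ is, up to sign, a cyclotomic polynomial, then all but finitely many primes $k$ are suitable. For every suitable $k$, $g_1(x)\,g_2(x)\,g_1(x^k)\,g_2(x^k)$ is an irreducible factorization of $f(x)f(x^k)$ of ratio $>1$. (b) Let $g_1=x^6-x^5+x^4-x^2+2x-1$, $g_2=x^6+2x^5+x^4-x^2-x-1$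 and $f=g_1g_2$. Then $f$ has degree $12$ and height $1$, and $g_1,g_2$ are irreducible of height $2$. All but finitely many primes $k$ are suitable for $f=g_1g_2$, and $k=13$ is suitable. For every suitable prime $k>12$ and every $m\ge 1$, the polynomial $\prod_{i=0}^{m-1} f(x^{k^i})$ has height $1$ and has exactly $2m$ irreducible factors, namely $g_1(x^{k^i})$ and $g_2(x^{k^i})$ for $0\le i<m$; these are pairwise non-associated and each has height $2$, so this irreducible factorization has ratio $>1$. (c) Consequently, for every positive even number $2m$ there is a polynomial of height $1$ in $\mathbb Z[x]$ with exactly $2m$ irreducible factors, pairwise non-associated and each of height $2$; in particular there are irreducible factorizations of ratio $>1$ with any positive even number of factors. -/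

import Mathlib

open Polynomial

namespace LongFactorization

noncomputable section

/-- The height of an integer polynomial: the largest absolute value of a coefficient. -/
abbrev height (p : ℤ[X]) : ℝ := p.supNorm

/-- `s` is (the multiset of factors of) an irreducible factorization of `p` in `ℤ[x]`. -/
def IsIrreducibleFactorization (p : ℤ[X]) (s : Multiset ℤ[X]) : Prop :=
  s.prod = p ∧ ∀ g ∈ s, Irreducible g

/-- The ratio of the factorization whose (nonempty) multiset of factors is `s`: the least height
of a factor divided by the height of the product. -/
def ratio (s : Multiset ℤ[X]) : ℝ :=
  sInf (height '' {g | g ∈ s}) / height s.prod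

/-- `g` is, up to sign, a cyclotomic polynomial. -/
def IsCyclotomic (g : ℤ[X]) : Prop :=
  ∃ n : ℕ, 0 < n ∧ Associated g (cyclotomic n ℤ)

/-- The exponent `k` is suitable for lengthening the factorization `f = g₁ * g₂`: the polynomial
`f(x) * f(x ^ k)` has height `height f ^ 2`, and `g₁(x ^ k)` and `g₂(x ^ k)` are irreducible. -/
def IsSuitable (g₁ g₂ : ℤ[X]) (k : ℕ) : Prop :=
  0 < k ∧
  height ((g₁ * g₂) * expand ℤ k (g₁ * g₂)) = height (g₁ * g₂) ^ 2 ∧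
  Irreducible (expand ℤ k g₁) ∧ Irreducible (expand ℤ k g₂)

/-- The first factor of the explicit example. -/
def exG₁ : ℤ[X] := X ^ 6 - X ^ 5 + X ^ 4 - X ^ 2 + 2 * X - 1

/-- The second factor of the explicit example. -/
def exG₂ : ℤ[X] := X ^ 6 + 2 * X ^ 5 + X ^ 4 - X ^ 2 - X - 1

/-- The product of the two factors of the explicit example. -/
def exF : ℤ[X] := exG₁ * exG₂

/-- The polynomial `f(x) * f(x ^ k) * ⋯ * f(x ^ (k ^ (m - 1)))`. -/
def longProduct (k m : ℕ) : ℤ[X] :=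
  ∏ i ∈ Finset.range m, expand ℤ (k ^ i) exF

/-- The factors `g₁(x ^ (k ^ i))` and `g₂(x ^ (k ^ i))`, for `i < m`. -/
def longFactors (k m : ℕ) : Multiset ℤ[X] :=
  (Multiset.range m).map (fun i => expand ℤ (k ^ i) exG₁) +
    (Multiset.range m).map (fun i => expand ℤ (k ^ i) exG₂)

/-- `p` has height `1`, and `s` lists its irreducible factors: there are exactly `2 * m` of them,
they are pairwise non-associated, and each has height `2`. -/
def IsLongExample (m : ℕ) (p : ℤ[X]) (s : Multiset ℤ[X]) : Prop :=
  height p = 1 ∧ IsIrreducibleFactorization p s ∧ Multiset.card s = 2 * m ∧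
  s.Pairwise (fun a b => ¬ Associated a b) ∧ ∀ g ∈ s, height g = 2

end

end LongFactorization

namespace LongFactorization

/-! Two independent facts carry the result. If k exceeds deg f, the products of coefficients of f(x)
and h(x^k) land in distinct degrees, so the height is multiplicative (`height_mul_expand`), while x
↦ x^k leaves the height of each factor unchanged.

Irreducibility of g(x^k) rests on Capelli's criterion: for k prime it fails only if a root a of g is
a k-th power b^k in ℚ(a). Such a b has degree at most deg g and Mahler measure at most the sum of
the absolute values of the coefficients of g, so Northcott's theorem leaves finitely many b. If one
b serves two primes, then b and a are roots of unity and g is cyclotomic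
(`finite_prime_not_irreducible_expand`). For odd k, not being a k-th power even gives irreducibility
of every g(x^(k^n)), so suitability propagates along the iteration (`irreducible_expand_pow`). In
the example, irreducibility is seen modulo 2, and k = 13 is settled by simple roots modulo 53 that
are not 13th powers, lifted by Hensel's lemma. -/

/-! ### Heights and the substitution x ↦ x^k -/

lemma height_le_iff {p : ℤ[X]} {B : ℝ} : height p ≤ B ↔ ∀ i, ‖p.coeff i‖ ≤ B := by
  refine ⟨fun h i => (p.le_supNorm i).trans h, fun h => ?_⟩
  obtain ⟨i, hi⟩ := p.exists_eq_supNorm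
  exact hi.trans_le (h i)

lemma height_eq_of_coeff {p : ℤ[X]} {B : ℝ} (h : ∀ i, ‖p.coeff i‖ ≤ B) (j : ℕ)
    (hj : ‖p.coeff j‖ = B) : height p = B :=
  le_antisymm (height_le_iff.2 h) (hj ▸ p.le_supNorm j)

lemma one_le_height {p : ℤ[X]} (hp : p ≠ 0) : 1 ≤ height p := by
  refine le_trans ?_ (p.le_supNorm p.natDegree)
  rw [Int.norm_eq_abs]
  exact_mod_cast Int.one_le_abs (leadingCoeff_ne_zero.2 hp)

lemma height_expand {k : ℕ} (hk : 0 < k) (p : ℤ[X]) : height (expand ℤ k p) = height p := by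
  refine le_antisymm (height_le_iff.2 fun i => ?_) (height_le_iff.2 fun i => ?_)
  · rw [coeff_expand hk]
    split_ifs
    · exact p.le_supNorm _
    · simpa using p.supNorm_nonneg
  · rw [← coeff_expand_mul hk]
    exact le_supNorm _ _

/-- Division with remainder: n = a + k * c with a ≤ deg f < k has at most one solution, so a single
term of the convolution survives. -/
lemma coeff_mul_expand {f : ℤ[X]} {k : ℕ} (hk : f.natDegree < k) (h : ℤ[X]) (n : ℕ) :
    (f * expand ℤ k h).coeff n = f.coeff (n % k) * h.coeff (n / k) := by
  have hk0 : 0 < k := by omega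
  rw [coeff_mul, Finset.sum_eq_single (n % k, k * (n / k))]
  · rw [coeff_expand hk0]
    simp [hk0]
  · rintro ⟨a, b⟩ hab hne
    rw [Finset.HasAntidiagonal.mem_antidiagonal] at hab
    simp only at hab ⊢
    by_cases ha : a < k
    · rw [coeff_expand hk0]
      split_ifs with hb
      · obtain ⟨c, rfl⟩ := hb
        exfalso
        apply hne
        rw [← hab, Nat.add_mul_mod_self_left, Nat.mod_eq_of_lt ha,
          Nat.add_mul_div_left _ _ hk0, Nat.div_eq_of_lt ha, zero_add]
      · simp
    · rw [coeff_eq_zero_of_natDegree_lt (by omega), zero_mul]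
  · intro h
    exact absurd (Finset.HasAntidiagonal.mem_antidiagonal.2 (Nat.mod_add_div n k)) h

lemma height_mul_expand {f : ℤ[X]} {k : ℕ} (hk : f.natDegree < k) (h : ℤ[X]) :
    height (f * expand ℤ k h) = height f * height h := by
  refine le_antisymm (height_le_iff.2 fun i => ?_) ?_
  · rw [coeff_mul_expand hk, norm_mul]
    exact mul_le_mul (f.le_supNorm _) (h.le_supNorm _) (norm_nonneg _) f.supNorm_nonneg
  · obtain ⟨i, hi⟩ := f.exists_eq_supNorm
    obtain ⟨j, hj⟩ := h.exists_eq_supNorm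
    by_cases hf : f.coeff i = 0
    · rw [height, hi, hf]
      simpa using supNorm_nonneg _
    have hik : i < k := (le_natDegree_of_ne_zero hf).trans_lt hk
    have := (f * expand ℤ k h).le_supNorm (i + k * j)
    rwa [coeff_mul_expand hk, Nat.add_mul_mod_self_left, Nat.mod_eq_of_lt hik,
      Nat.add_mul_div_left _ _ (by omega), Nat.div_eq_of_lt hik, zero_add, norm_mul,
      ← hi, ← hj] at this

lemma one_lt_ratio {s : Multiset ℤ[X]} (hs : s ≠ 0) (h0 : s.prod ≠ 0)
    (h : ∀ g ∈ s, height s.prod < height g) : 1 < ratio s := by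
  have hpos : 0 < height s.prod := zero_lt_one.trans_le (one_le_height h0)
  rw [ratio, one_lt_div hpos]
  have hfin : (height '' {g | g ∈ s}).Finite := by
    classical
    refine Set.Finite.image _ (s.toFinset.finite_toSet.subset fun g hg => ?_)
    simpa using hg
  obtain ⟨g, hg⟩ := Multiset.exists_mem_of_ne_zero hs
  have hne : (height '' {g | g ∈ s}).Nonempty := ⟨height g, g, hg, rfl⟩
  obtain ⟨g', hg', he⟩ := hne.csInf_mem hfin
  rw [← he]
  exact h g' hg'

-- Capelli's criterion

universe u

/-- Capelli's criterion, reduced to the irreducibility of `X ^ n - α` over `F(α)`. -/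
lemma irreducible_expand_of_forall {F : Type u} [Field F] {G : F[X]} (hG : Irreducible G) (n : ℕ)
    (h : ∀ (K : Type u) [Field K] [Algebra F K] (a : K),
      -- These two conditions say that K = F(a) with a a root of G.
      (∀ b : K, ∃ r : F[X], aeval a r = b) → (∀ r : F[X], aeval a r = 0 ↔ G ∣ r) →
      Irreducible (X ^ n - C a)) :
    Irreducible (expand F n G) := by
  have hu : IsUnit (C G.leadingCoeff⁻¹) :=
    isUnit_C.2 (isUnit_iff_ne_zero.2 (inv_ne_zero (leadingCoeff_ne_zero.2 hG.ne_zero)))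
  have has : Associated G (G * C G.leadingCoeff⁻¹) := (associated_mul_isUnit_right_iff hu).2 (.refl _)
  have hm : (G * C G.leadingCoeff⁻¹).Monic := monic_mul_leadingCoeff_inv hG.ne_zero
  have hi := has.irreducible hG
  have hc := irreducible_comp (g := X ^ n) hm (monic_X_pow n) hi ?_
  · rw [← expand_eq_comp_X_pow, map_mul, expand_C] at hc
    exact ((associated_mul_isUnit_right_iff hu).2 (.refl _)).symm.irreducible hc
  · intro E _ _ x hx
    have hint : IsIntegral F x := by
      by_contra hx'
      rw [minpoly.eq_zero hx'] at hx
      exact hi.ne_zero hx.symm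
    rw [Polynomial.map_pow, map_X]
    refine h (IntermediateField.adjoin F {x}) _ (fun b => ?_) (fun r => ?_)
    · have hb := b.2
      rw [← IntermediateField.mem_toSubalgebra,
        IntermediateField.adjoin_simple_toSubalgebra_of_isAlgebraic hint.isAlgebraic,
        Algebra.adjoin_singleton_eq_range_aeval] at hb
      obtain ⟨r, hr⟩ := hb
      refine ⟨r, Subtype.ext ?_⟩
      rw [← hr]
      simp [← IntermediateField.aeval_coe]
    · rw [has.dvd_iff_dvd_left, ← hx, ← minpoly.dvd_iff, IntermediateField.minpoly_gen]

/-- Every element of F(a) is r(a) for a polynomial r, so "a is not a p-th power in F(a)" becomes a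
divisibility statement free of extension fields. -/
lemma irreducible_expand_of_not_pow {F : Type u} [Field F] {G : F[X]} (hG : Irreducible G) {p : ℕ}
    (hp : p.Prime) (h : ∀ r : F[X], ¬ G ∣ r ^ p - X) : Irreducible (expand F p G) := by
  refine irreducible_expand_of_forall hG p fun K _ _ a hs hd =>
    X_pow_sub_C_irreducible_of_prime hp fun b hb => ?_
  obtain ⟨r, rfl⟩ := hs b
  exact h r ((hd _).1 (by simp [hb]))

/-- The prime 2 is excluded because of factorizations such as that of X^4 + 4. -/
lemma irreducible_expand_pow_of_not_pow {F : Type u} [Field F] {G : F[X]} (hG : Irreducible G)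
    {p : ℕ} (hp : p.Prime) (hp2 : p ≠ 2) (n : ℕ) (h : ∀ r : F[X], ¬ G ∣ r ^ p - X) :
    Irreducible (expand F (p ^ n) G) := by
  refine irreducible_expand_of_forall hG _ fun K _ _ a hs hd =>
    X_pow_sub_C_irreducible_of_prime_pow hp hp2 n fun b hb => ?_
  obtain ⟨r, rfl⟩ := hs b
  exact h r ((hd _).1 (by simp [hb]))

/-- Modulo G, r^k ≡ X and hence G(r^k) ≡ G(X) ≡ 0. -/
lemma dvd_comp_pow {F : Type u} [Field F] {G r : F[X]} {k : ℕ} (h : G ∣ r ^ k - X) :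
    G ∣ (expand F k G).comp r := by
  have h1 : r ^ k - X ∣ G.comp (r ^ k) - G.comp X := by
    simpa [comp, eval₂_eq_eval_map] using sub_dvd_eval_sub (r ^ k) X (G.map C)
  rw [comp_X] at h1
  have h2 := dvd_add (h.trans h1) (dvd_refl G)
  rw [sub_add_cancel] at h2
  rwa [expand_eq_comp_X_pow, comp_assoc, X_pow_comp]

/-- The class of r in F[X]/(G) is a root of H, and its degree over F is at most the dimension of
that field. -/
lemma natDegree_le_of_dvd_comp {F : Type u} [Field F] {G H r : F[X]} (hG : Irreducible G)
    (hH : Irreducible H) (h : G ∣ H.comp r) : H.natDegree ≤ G.natDegree := by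
  have := Fact.mk hG
  have hroot : aeval (aeval (AdjoinRoot.root G) r) H = 0 := by
    rw [← aeval_comp, AdjoinRoot.aeval_eq, AdjoinRoot.mk_eq_zero]
    exact h
  have : FiniteDimensional F (AdjoinRoot G) := (AdjoinRoot.powerBasis hG.ne_zero).finite
  rw [← natDegree_mul_C (a := H.leadingCoeff⁻¹) (inv_ne_zero (leadingCoeff_ne_zero.2 hH.ne_zero)),
    minpoly.eq_of_irreducible hH hroot]
  refine (minpoly.natDegree_le _).trans_eq ?_
  rw [(AdjoinRoot.powerBasis hG.ne_zero).finrank, AdjoinRoot.powerBasis_dim]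

/-- Otherwise G(x^k), irreducible of degree k * deg G, would have a root in a field of degree deg G.
-/
lemma not_dvd_pow_sub_X {F : Type u} [Field F] {G : F[X]} {k : ℕ} (hk : 1 < k)
    (h : Irreducible (expand F k G)) (r : F[X]) : ¬ G ∣ r ^ k - X := by
  intro hr
  have hG : Irreducible G := of_irreducible_expand (by omega) h
  have := natDegree_le_of_dvd_comp hG h (dvd_comp_pow hr)
  rw [natDegree_expand] at this
  have := hG.natDegree_pos
  nlinarith

/-! ### Finiteness of exceptional primes, by Mahler measure -/

lemma sum_norm_coeff_expand {k : ℕ} (hk : 0 < k) (g : ℤ[X]) :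
    ((expand ℤ k g).sum fun _ a => ‖a‖) = g.sum fun _ a => ‖a‖ := by
  symm
  rw [sum_def, sum_def]
  refine Finset.sum_bij_ne_zero (fun i _ _ => i * k) (fun i hi _ => ?_) (fun i _ _ j _ _ h => ?_)
    (fun i hi _ => ?_) (fun i _ _ => ?_)
  · simpa [coeff_expand_mul hk] using hi
  · exact Nat.eq_of_mul_eq_mul_right hk h
  · rw [mem_support_iff, coeff_expand hk] at hi
    split_ifs at hi with hd
    · obtain ⟨j, rfl⟩ := hd
      rw [Nat.mul_div_cancel_left _ hk] at hi
      exact ⟨j, by simpa using hi, by simpa using hi, mul_comm _ _⟩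
    · exact absurd rfl hi
  · rw [coeff_expand_mul hk]

/-- Mahler measure is multiplicative, and the cofactor, a nonzero integer polynomial, has measure at
least 1. -/
lemma mahlerMeasure_le_of_dvd {h p : ℤ[X]} (hp : p ≠ 0) (hd : h ∣ p) :
    (h.map (Int.castRingHom ℂ)).mahlerMeasure ≤ p.sum fun _ a => ‖a‖ := by
  obtain ⟨q, rfl⟩ := hd
  have hq := one_le_mahlerMeasure_of_ne_zero (right_ne_zero_of_mul hp)
  have hle := mapMahlerMeasure_le_sum_norm_coeff (h * q) (Int.castRingHom ℂ)
    (AddMonoidHomClass.isometry_of_norm _ fun z => by simp [Int.norm_eq_abs])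
  rw [mapMahlerMeasure_mul] at hle
  exact (le_mul_of_one_le_right (mahlerMeasure_nonneg _) hq).trans hle

lemma exists_irreducible_dvd_of_aeval_eq_zero {A : Type*} [CommRing A] [IsDomain A] {p : ℤ[X]}
    (hp : p ≠ 0) {b : A} (hb : aeval b p = 0) : ∃ h, Irreducible h ∧ h ∣ p ∧ aeval b h = 0 := by
  obtain ⟨s, hs, hsp⟩ := UniqueFactorizationMonoid.exists_prime_factors p hp
  have h0 : aeval b s.prod = 0 := by
    obtain ⟨q, hq⟩ := hsp.symm.dvd
    rw [hq, map_mul, hb, zero_mul]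
  rw [map_multiset_prod, Multiset.prod_eq_zero_iff, Multiset.mem_map] at h0
  obtain ⟨h, hh, h0⟩ := h0
  exact ⟨h, (hs h hh).irreducible, (Multiset.dvd_prod hh).trans hsp.dvd, h0⟩

lemma natDegree_ne_zero_of_aeval {h : ℤ[X]} (hh : h ≠ 0) {b : ℂ} (hb : aeval b h = 0) :
    h.natDegree ≠ 0 := by
  intro h0
  rw [eq_C_of_natDegree_eq_zero h0] at hb hh
  simp_all

lemma irreducible_map_rat {g : ℤ[X]} (hg : Irreducible g) (hd : g.natDegree ≠ 0) :
    Irreducible (g.map (Int.castRingHom ℚ)) :=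
  (IsPrimitive.Int.irreducible_iff_irreducible_map_cast (hg.isPrimitive hd)).1 hg

lemma irreducible_expand_of_map {g : ℤ[X]} (hg : Irreducible g) (hd : g.natDegree ≠ 0) {k : ℕ}
    (hk : 0 < k) (h : Irreducible (expand ℚ k (g.map (Int.castRingHom ℚ)))) :
    Irreducible (expand ℤ k g) := by
  rw [← map_expand] at h
  refine (IsPrimitive.Int.irreducible_iff_irreducible_map_cast ?_).2 h
  intro r hr
  refine hg.isPrimitive hd r ((C_dvd_iff_dvd_coeff _ _).2 fun i => ?_)
  rw [← coeff_expand_mul hk]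
  exact (C_dvd_iff_dvd_coeff _ _).1 hr _

lemma isCyclotomic_of_pow_eq_one {g : ℤ[X]} (hg : Irreducible g) {a : ℂ} (ha : aeval a g = 0)
    {n : ℕ} (hn : 0 < n) (h1 : a ^ n = 1) : IsCyclotomic g := by
  obtain ⟨m, hm, hprim⟩ := IsPrimitiveRoot.exists_pos h1 hn.ne'
  refine ⟨m, hm, ?_⟩
  have hd : cyclotomic m ℤ ∣ g := by
    rw [cyclotomic_eq_minpoly hprim hm]
    exact minpoly.isIntegrallyClosed_dvd (hprim.isIntegral hm) ha
  exact ((cyclotomic.irreducible hm).associated_of_dvd hg hd).symm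

/-- If the root `a` of `g` is a `k`-th power in `ℚ(a)`, a `k`-th root of it is a root of an integer
polynomial whose degree and Mahler measure are bounded independently of `k`. -/
lemma exists_pow_eq_of_not_irreducible_expand {g : ℤ[X]} (hg : Irreducible g) {a : ℂ}
    (ha : aeval a g = 0) {k : ℕ} (hk : k.Prime) (h : ¬ Irreducible (expand ℤ k g)) :
    ∃ b : ℂ, b ^ k = a ∧ ∃ q : ℤ[X], q ≠ 0 ∧ aeval b q = 0 ∧ q.natDegree ≤ g.natDegree ∧
      (q.map (Int.castRingHom ℂ)).mahlerMeasure ≤ g.sum fun _ c => ‖c‖ := by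
  have hd := natDegree_ne_zero_of_aeval hg.ne_zero ha
  have hG := irreducible_map_rat hg hd
  have hGa : aeval a (g.map (Int.castRingHom ℚ)) = 0 := by
    rw [← algebraMap_int_eq, aeval_map_algebraMap, ha]
  have hr : ∃ r : ℚ[X], g.map (Int.castRingHom ℚ) ∣ r ^ k - X := by
    by_contra! hr
    exact h (irreducible_expand_of_map hg hd hk.pos (irreducible_expand_of_not_pow hG hk hr))
  obtain ⟨r, hr⟩ := hr
  have hb : aeval a r ^ k = a := by
    obtain ⟨s, hs⟩ := hr
    have := congrArg (aeval a) hs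
    rwa [map_mul, hGa, zero_mul, map_sub, map_pow, aeval_X, sub_eq_zero] at this
  have he0 : expand ℤ k g ≠ 0 := (expand_ne_zero hk.pos).2 hg.ne_zero
  obtain ⟨q, hq, hqd, hqb⟩ := exists_irreducible_dvd_of_aeval_eq_zero he0
    (show aeval (aeval a r) (expand ℤ k g) = 0 by rw [expand_aeval, hb, ha])
  refine ⟨aeval a r, hb, q, hq.ne_zero, hqb, ?_, ?_⟩
  · have hQ := irreducible_map_rat hq (natDegree_ne_zero_of_aeval hq.ne_zero hqb)
    have hle := natDegree_le_of_dvd_comp (r := r) hG hQ ?_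
    · simpa [natDegree_map_eq_of_injective (Int.castRingHom ℚ).injective_int] using hle
    · have hc : aeval a ((q.map (Int.castRingHom ℚ)).comp r) = 0 := by
        rw [aeval_comp, ← algebraMap_int_eq, aeval_map_algebraMap, hqb]
      -- If G did not divide q ∘ r, a Bézout relation evaluated at a would read 0 = 1.
      by_contra hnd
      obtain ⟨u, v, huv⟩ := (hG.coprime_iff_not_dvd).2 hnd
      have := congrArg (aeval a) huv
      simp [hGa, hc] at this
  · rw [← sum_norm_coeff_expand hk.pos]
    exact mahlerMeasure_le_of_dvd he0 hqd

theorem finite_prime_not_irreducible_expand {g : ℤ[X]} (hg : Irreducible g)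
    (hd : g.natDegree ≠ 0) (h0 : g.coeff 0 ≠ 0) (hc : ¬ IsCyclotomic g) :
    {k : ℕ | k.Prime ∧ ¬ Irreducible (expand ℤ k g)}.Finite := by
  obtain ⟨a, ha⟩ : ∃ a : ℂ, aeval a g = 0 := by
    obtain ⟨a, ha⟩ := IsAlgClosed.exists_root (g.map (Int.castRingHom ℂ)) (by
      rw [degree_map_eq_of_injective (Int.castRingHom ℂ).injective_int]
      exact fun h => hd (natDegree_eq_of_degree_eq_some h))
    exact ⟨a, by rwa [IsRoot.def, eval_map, ← algebraMap_int_eq, ← aeval_def] at ha⟩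
  have ha0 : a ≠ 0 := by
    rintro rfl
    rw [← coeff_zero_eq_aeval_zero'] at ha
    exact h0 (by simpa using ha)
  have hL : 0 ≤ g.sum fun _ c => ‖c‖ := Finset.sum_nonneg fun _ _ => norm_nonneg _
  set T : Set ℤ[X] := {p : ℤ[X] | p.natDegree ≤ g.natDegree ∧
    (p.map (Int.castRingHom ℂ)).mahlerMeasure ≤ g.sum fun _ c => ‖c‖}
  -- Northcott's theorem; the bounds defining `T` do not involve k, so the roots `β k` lie in one
  -- finite set.
  have hT : T.Finite := finite_mahlerMeasure_le g.natDegree ⟨_, hL⟩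
  have hR : (⋃ q ∈ T, q.rootSet ℂ).Finite := hT.biUnion fun q _ => q.rootSet_finite ℂ
  by_contra hinf
  choose! β hβ hβ' using fun k (hk : k ∈ {k : ℕ | k.Prime ∧ ¬ Irreducible (expand ℤ k g)}) =>
    exists_pow_eq_of_not_irreducible_expand hg ha hk.1 hk.2
  obtain ⟨k, hk, l, hl, hkl, he⟩ := Set.Infinite.exists_ne_map_eq_of_mapsTo hinf
    (f := β) (t := ⋃ q ∈ T, q.rootSet ℂ) (fun k hk => by
      obtain ⟨q, hq0, hq, hqd, hqm⟩ := hβ' k hk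
      exact Set.mem_biUnion (show q ∈ T from ⟨hqd, hqm⟩) (mem_rootSet.2 ⟨hq0, hq⟩)) hR
  wlog hlt : k < l generalizing k l
  · exact this l hl k hk hkl.symm he.symm (by omega)
  have hb0 : β k ≠ 0 := by
    intro hb
    have := hβ k hk
    rw [hb, zero_pow hk.1.ne_zero] at this
    exact ha0 this.symm
  -- Both β^k and β^l equal a ≠ 0, so β^(l - k) = 1.
  have h1 : β k ^ (l - k) = 1 := by
    have : β k ^ k * β k ^ (l - k) = β k ^ k * 1 := by
      rw [← pow_add, Nat.add_sub_cancel' hlt.le, mul_one, hβ k hk, he, hβ l hl]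
    exact mul_left_cancel₀ (pow_ne_zero _ hb0) this
  refine hc (isCyclotomic_of_pow_eq_one hg ha (n := l - k) (by omega) ?_)
  rw [← hβ k hk, ← pow_mul, mul_comm, pow_mul, h1, one_pow]

/-! ### One lengthening step -/

section Step

variable {g₁ g₂ : ℤ[X]}

/-- A constant factor has height at most that of the product, which is at least 1 and so at most its
own square. -/
lemma natDegree_ne_zero_of_height_lt (h₁ : g₁ ≠ 0) (h₂ : g₂ ≠ 0)
    (h : height (g₁ * g₂) ^ 2 < height g₁) : g₁.natDegree ≠ 0 := by
  intro h0
  have h1 := one_le_height (mul_ne_zero h₁ h₂)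
  have : height g₁ ≤ height (g₁ * g₂) := by
    obtain ⟨c, rfl⟩ : ∃ c, g₁ = C c := ⟨_, eq_C_of_natDegree_eq_zero h0⟩
    rw [height_le_iff]
    intro i
    obtain ⟨j, hj⟩ := g₂.exists_eq_supNorm
    refine le_trans ?_ (le_supNorm _ j)
    have := one_le_height h₂
    rw [coeff_C_mul, norm_mul, ← hj]
    refine le_trans ?_ (le_mul_of_one_le_right (norm_nonneg _) this)
    rw [coeff_C]
    split_ifs <;> simp
  nlinarith

lemma coeff_zero_ne_zero_of_one_lt_height (h₁ : Irreducible g₁) (h : 1 < height g₁) :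
    g₁.coeff 0 ≠ 0 := by
  intro h0
  obtain ⟨u, rfl⟩ := (irreducible_X.associated_of_dvd h₁ (X_dvd_iff.2 h0))
  obtain ⟨c, hc, hu⟩ := isUnit_iff.1 u.isUnit
  rw [← hu, X_mul_C, C_mul_X_eq_monomial, height, supNorm_monomial] at h
  rcases Int.isUnit_iff.1 hc with rfl | rfl <;> simp at h

lemma finite_prime_not_isSuitable (h₁ : Irreducible g₁) (h₂ : Irreducible g₂)
    (hlt : height (g₁ * g₂) ^ 2 < min (height g₁) (height g₂))
    (hc₁ : ¬ IsCyclotomic g₁) (hc₂ : ¬ IsCyclotomic g₂) :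
    {k : ℕ | k.Prime ∧ ¬ IsSuitable g₁ g₂ k}.Finite := by
  rw [lt_min_iff] at hlt
  have hf := one_le_height (mul_ne_zero h₁.ne_zero h₂.ne_zero)
  refine ((Set.finite_le_nat (g₁ * g₂).natDegree).union
    ((finite_prime_not_irreducible_expand h₁
      (natDegree_ne_zero_of_height_lt h₁.ne_zero h₂.ne_zero hlt.1)
      (coeff_zero_ne_zero_of_one_lt_height h₁ (by nlinarith)) hc₁).union
    (finite_prime_not_irreducible_expand h₂
      (natDegree_ne_zero_of_height_lt h₂.ne_zero h₁.ne_zero (mul_comm g₁ g₂ ▸ hlt.2))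
      (coeff_zero_ne_zero_of_one_lt_height h₂ (by nlinarith)) hc₂))).subset ?_
  rintro k ⟨hk, hns⟩
  by_contra hk'
  simp only [Set.mem_union, Set.mem_ofPred_eq, not_or, not_and, not_not, not_le] at hk'
  exact hns ⟨hk.pos, by rw [height_mul_expand hk'.1, sq], hk'.2.1 hk, hk'.2.2 hk⟩

lemma isIrreducibleFactorization_of_isSuitable (h₁ : Irreducible g₁) (h₂ : Irreducible g₂) {k : ℕ}
    (hk : IsSuitable g₁ g₂ k) :
    IsIrreducibleFactorization (g₁ * g₂ * expand ℤ k (g₁ * g₂))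
      {g₁, g₂, expand ℤ k g₁, expand ℤ k g₂} := by
  refine ⟨by simp [mul_assoc], fun g hg => ?_⟩
  simp only [Multiset.insert_eq_cons, Multiset.mem_cons, Multiset.mem_singleton] at hg
  rcases hg with rfl | rfl | rfl | rfl
  exacts [h₁, h₂, hk.2.2.1, hk.2.2.2]

lemma one_lt_ratio_of_isSuitable (h₁ : Irreducible g₁) (h₂ : Irreducible g₂) {k : ℕ}
    (hk : IsSuitable g₁ g₂ k) (hlt : height (g₁ * g₂) ^ 2 < min (height g₁) (height g₂)) :
    1 < ratio {g₁, g₂, expand ℤ k g₁, expand ℤ k g₂} := by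
  have hp := (isIrreducibleFactorization_of_isSuitable h₁ h₂ hk).1
  have h0 := mul_ne_zero h₁.ne_zero h₂.ne_zero
  rw [lt_min_iff] at hlt
  refine one_lt_ratio (by simp) ?_ fun g hg => ?_
  · rw [hp]
    exact mul_ne_zero h0 ((expand_ne_zero hk.1).2 h0)
  · rw [hp, hk.2.1]
    simp only [Multiset.insert_eq_cons, Multiset.mem_cons, Multiset.mem_singleton] at hg
    rcases hg with rfl | rfl | rfl | rfl
    · exact hlt.1
    · exact hlt.2
    · rw [height_expand hk.1]; exact hlt.1
    · rw [height_expand hk.1]; exact hlt.2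

end Step

/-! ### Local tests for irreducibility and for not being cyclotomic -/

/-- By Hensel's lemma, a simple root of `g` modulo `q` that is not a `k`-th power modulo `q`
prevents `X` from being a `k`-th power modulo `g`. -/
lemma not_dvd_pow_sub_X_of_simple_root {g : ℤ[X]} {q : ℕ} [Fact q.Prime] {k : ℕ} (hk : k ≠ 0)
    (n : ℤ) (hn : (q : ℤ) ∣ g.eval n) (hn' : ¬ (q : ℤ) ∣ g.derivative.eval n)
    (hpow : ∀ c : ZMod q, c ^ k ≠ n) (r : ℚ[X]) :
    ¬ g.map (Int.castRingHom ℚ) ∣ r ^ k - X := by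
  have haev (p : ℤ[X]) : aeval (n : ℤ_[q]) p = ((p.eval n : ℤ) : ℤ_[q]) := by
    simpa using aeval_algebraMap_apply_eq_algebraMap_eval (A := ℤ_[q]) n p
  have hder : ‖aeval (n : ℤ_[q]) g.derivative‖ = 1 := by
    rw [haev]
    exact le_antisymm (PadicInt.norm_le_one _)
      (not_lt.1 fun h => hn' ((PadicInt.norm_int_lt_one_iff_dvd _).1 h))
  obtain ⟨z, hz, hzn, -⟩ := hensels_lemma (F := g) (a := (n : ℤ_[q])) (by
    rw [hder, one_pow, haev]
    exact (PadicInt.norm_int_lt_one_iff_dvd _).2 hn)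
  rw [hder] at hzn
  intro hdvd
  have hzq : aeval (z : ℚ_[q]) (g.map (Int.castRingHom ℚ)) = 0 := by
    rw [← algebraMap_int_eq, aeval_map_algebraMap]
    have := aeval_algebraMap_apply ℚ_[q] z g
    rw [hz, map_zero] at this
    exact this
  have hw : aeval (z : ℚ_[q]) r ^ k = z := by
    obtain ⟨s, hs⟩ := hdvd
    have := congrArg (aeval (z : ℚ_[q])) hs
    rwa [map_mul, hzq, zero_mul, map_sub, map_pow, aeval_X, sub_eq_zero] at this
  -- The k-th root of a q-adic integer is itself integral, so it can be reduced modulo q.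
  have hw1 : ‖aeval (z : ℚ_[q]) r‖ ≤ 1 := by
    rw [← pow_le_one_iff_of_nonneg (norm_nonneg _) hk, ← norm_pow, hw]
    exact z.2
  set w : ℤ_[q] := ⟨_, hw1⟩ with hwdef
  have hwz : w ^ k = z := Subtype.ext (by rw [PadicInt.coe_pow]; exact hw)
  refine hpow (PadicInt.toZMod w) ?_
  rw [← map_pow, hwz, ← sub_eq_zero, ← map_intCast (PadicInt.toZMod (p := q)), ← map_sub,
    ← RingHom.mem_ker, PadicInt.ker_toZMod]
  exact PadicInt.mem_nonunits.2 hzn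

lemma irreducible_expand_of_simple_root {g : ℤ[X]} (hg : Irreducible g) (hd : g.natDegree ≠ 0)
    {q : ℕ} [Fact q.Prime] {k : ℕ} (hk : k.Prime)
    (n : ℤ) (hn : (q : ℤ) ∣ g.eval n) (hn' : ¬ (q : ℤ) ∣ g.derivative.eval n)
    (hpow : ∀ c : ZMod q, c ^ k ≠ n) : Irreducible (expand ℤ k g) :=
  irreducible_expand_of_map hg hd hk.pos (irreducible_expand_of_not_pow (irreducible_map_rat hg hd)
    hk (not_dvd_pow_sub_X_of_simple_root hk.ne_zero n hn hn' hpow))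

lemma irreducible_expand_pow {g : ℤ[X]} (hg : Irreducible g) (hd : g.natDegree ≠ 0) {k : ℕ}
    (hk : k.Prime) (hk2 : k ≠ 2) (h : Irreducible (expand ℤ k g)) (n : ℕ) :
    Irreducible (expand ℤ (k ^ n) g) := by
  have h' := irreducible_map_rat h (by rw [natDegree_expand]; exact mul_ne_zero hd hk.ne_zero)
  rw [map_expand] at h'
  exact irreducible_expand_of_map hg hd (pow_pos hk.pos n) (irreducible_expand_pow_of_not_pow
    (irreducible_map_rat hg hd) hk hk2 n (not_dvd_pow_sub_X hk.one_lt h'))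

/-- The sign change yields a real root strictly between 0 and 1, which is not a root of unity. -/
lemma not_isCyclotomic_of_sign_change {g : ℤ[X]} (h0 : g.eval 0 < 0) (h1 : 0 < g.eval 1) :
    ¬ IsCyclotomic g := by
  rintro ⟨n, hn, ha⟩
  have hcont : ContinuousOn (fun x : ℝ => aeval x g) (Set.Icc 0 1) := by fun_prop
  have e0 : aeval (0 : ℝ) g = (g.eval 0 : ℤ) := by
    simpa using aeval_algebraMap_apply_eq_algebraMap_eval (A := ℝ) (0 : ℤ) g
  have e1 : aeval (1 : ℝ) g = (g.eval 1 : ℤ) := by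
    simpa using aeval_algebraMap_apply_eq_algebraMap_eval (A := ℝ) (1 : ℤ) g
  obtain ⟨x, hx, hx0⟩ := intermediate_value_Ioo zero_le_one hcont
    (show (0 : ℝ) ∈ _ from ⟨by simp only [e0]; exact_mod_cast h0,
      by simp only [e1]; exact_mod_cast h1⟩)
  obtain ⟨q, hq⟩ := ha.dvd.trans (cyclotomic.dvd_X_pow_sub_one n ℤ)
  have := congrArg (aeval x) hq
  simp only at hx0
  rw [map_mul, hx0, zero_mul, map_sub, map_pow, aeval_X, map_one, sub_eq_zero] at this
  exact (pow_lt_one₀ hx.1.le hx.2 hn.ne').ne this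

/-! ### The two explicit sextics -/

lemma monic_exG₁ : exG₁.Monic := by unfold exG₁; monicity!

lemma monic_exG₂ : exG₂.Monic := by unfold exG₂; monicity!

lemma natDegree_exG₁ : exG₁.natDegree = 6 := by unfold exG₁; compute_degree!

lemma natDegree_exG₂ : exG₂.natDegree = 6 := by unfold exG₂; compute_degree!

lemma natDegree_exF : exF.natDegree = 12 := by
  rw [exF, monic_exG₁.natDegree_mul monic_exG₂, natDegree_exG₁, natDegree_exG₂]

lemma exF_eq : exF = X ^ 12 + X ^ 11 + X ^ 9 - X ^ 8 + X ^ 6 - X ^ 4 - X ^ 3 - X + 1 := by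
  unfold exF exG₁ exG₂; ring

lemma height_exF : height exF = 1 := by
  refine height_eq_of_coeff (fun i => ?_) 0 (by simp [exF_eq, coeff_one, coeff_X])
  rcases le_or_gt i 12 with hi | hi
  · interval_cases i <;> simp [exF_eq, coeff_one, coeff_X, coeff_X_pow]
  · rw [coeff_eq_zero_of_natDegree_lt (by rwa [natDegree_exF])]
    simp

lemma height_exG₁ : height exG₁ = 2 := by
  refine height_eq_of_coeff (fun i => ?_) 1 (by simp [exG₁, coeff_one, coeff_X, coeff_X_pow, Int.norm_eq_abs])
  rcases le_or_gt i 6 with hi | hi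
  · interval_cases i <;> simp [exG₁, coeff_one, coeff_X, coeff_X_pow, Int.norm_eq_abs]
  · rw [coeff_eq_zero_of_natDegree_lt (by rwa [natDegree_exG₁])]
    simp

lemma height_exG₂ : height exG₂ = 2 := by
  refine height_eq_of_coeff (fun i => ?_) 5 (by simp [exG₂, coeff_one, coeff_X, coeff_X_pow, Int.norm_eq_abs])
  rcases le_or_gt i 6 with hi | hi
  · interval_cases i <;> simp [exG₂, coeff_one, coeff_X, coeff_X_pow, Int.norm_eq_abs]
  · rw [coeff_eq_zero_of_natDegree_lt (by rwa [natDegree_exG₂])]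
    simp

/-- A monic sextic over `𝔽₂` with no factor of degree at most three; both factors of the example
reduce to one of this form. -/
lemma irreducible_sextic_zmod_two {p : (ZMod 2)[X]} (hm : p.Monic) (hd : p.natDegree = 6)
    (h0 : p.coeff 0 = 1) (h2 : p.coeff 2 = 1) (h3 : p.coeff 3 = 0) (h4 : p.coeff 4 = 1)
    (h15 : p.coeff 1 + p.coeff 5 = 1) : Irreducible p := by
  have h1 : p ≠ 1 := by rintro rfl; simp at hd
  rw [hm.irreducible_iff_natDegree', hd]
  refine ⟨h1, ?_⟩
  rintro a b ha hb rfl hab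
  rw [ha.natDegree_mul hb] at hd
  rw [Finset.mem_Ioc] at hab
  have hc := fun n => coeff_mul a b n
  simp only [Finset.Nat.sum_antidiagonal_eq_sum_range_succ_mk] at hc
  rw [hc] at h0 h2 h3 h4
  rw [hc, hc] at h15
  have ha' := ha.coeff_natDegree
  have hb' := hb.coeff_natDegree
  obtain ⟨hab1, hab2⟩ := hab
  have hz (c : (ZMod 2)[X]) (i : ℕ) : c.natDegree < i → c.coeff i = 0 :=
    coeff_eq_zero_of_natDegree_lt
  have hza := hz a
  have hzb := hz b
  norm_num at hab2
  -- In each case the constant terms are both 1, and the few remaining coefficients are ruled out by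
  -- enumeration over 𝔽₂.
  obtain h | h | h : b.natDegree = 1 ∨ b.natDegree = 2 ∨ b.natDegree = 3 := by omega
  · have h' : a.natDegree = 5 := by omega
    rw [h] at hb' hzb
    rw [h'] at ha'
    simp [Finset.sum_range_succ, ha', hb', hzb] at h0 h2 h3 h4 h15
    generalize a.coeff 0 = a0 at *
    generalize a.coeff 1 = a1 at *
    generalize a.coeff 2 = a2 at *
    generalize a.coeff 3 = a3 at *
    generalize a.coeff 4 = a4 at *
    generalize b.coeff 0 = b0 at *
    clear hc hz hza hzb ha hb hm h1 h h' hd hab1 hab2 ha' hb'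
    obtain ⟨rfl, rfl⟩ := h0
    revert a1 a2 a3 a4
    decide
  · have h' : a.natDegree = 4 := by omega
    rw [h] at hb' hzb
    rw [h'] at ha' hza
    simp [Finset.sum_range_succ, ha', hb', hzb, hza] at h0 h2 h3 h4 h15
    generalize a.coeff 0 = a0 at *
    generalize a.coeff 1 = a1 at *
    generalize a.coeff 2 = a2 at *
    generalize a.coeff 3 = a3 at *
    generalize b.coeff 0 = b0 at *
    generalize b.coeff 1 = b1 at *
    clear hc hz hza hzb ha hb hm h1 h h' hd hab1 hab2 ha' hb'
    obtain ⟨rfl, rfl⟩ := h0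
    revert a1 a2 a3 b1
    decide
  · have h' : a.natDegree = 3 := by omega
    rw [h] at hb' hzb
    rw [h'] at ha' hza
    simp [Finset.sum_range_succ, ha', hb', hzb, hza] at h0 h2 h3 h4 h15
    generalize a.coeff 0 = a0 at *
    generalize a.coeff 1 = a1 at *
    generalize a.coeff 2 = a2 at *
    generalize b.coeff 0 = b0 at *
    generalize b.coeff 1 = b1 at *
    generalize b.coeff 2 = b2 at *
    clear hc hz hza hzb ha hb hm h1 h h' hd hab1 hab2 ha' hb'
    obtain ⟨rfl, rfl⟩ := h0
    revert a1 a2 b1 b2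
    decide

lemma irreducible_exG₁ : Irreducible exG₁ := by
  refine monic_exG₁.irreducible_of_irreducible_map (Int.castRingHom (ZMod 2)) _
    (irreducible_sextic_zmod_two (monic_exG₁.map _)
      (by rw [monic_exG₁.natDegree_map, natDegree_exG₁]) ?_ ?_ ?_ ?_ ?_) <;>
  simp [exG₁, coeff_one, coeff_X, coeff_X_pow]
  decide

lemma irreducible_exG₂ : Irreducible exG₂ := by
  refine monic_exG₂.irreducible_of_irreducible_map (Int.castRingHom (ZMod 2)) _
    (irreducible_sextic_zmod_two (monic_exG₂.map _)
      (by rw [monic_exG₂.natDegree_map, natDegree_exG₂]) ?_ ?_ ?_ ?_ ?_) <;>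
  simp [exG₂, coeff_one, coeff_X, coeff_X_pow]
  decide

lemma not_isCyclotomic_exG₁ : ¬ IsCyclotomic exG₁ :=
  not_isCyclotomic_of_sign_change (by simp [exG₁]) (by simp [exG₁])

lemma not_isCyclotomic_exG₂ : ¬ IsCyclotomic exG₂ :=
  not_isCyclotomic_of_sign_change (by simp [exG₂]) (by simp [exG₂])

lemma irreducible_expand_thirteen_exG₁ : Irreducible (expand ℤ 13 exG₁) := by
  -- Since 53 = 4 * 13 + 1, the nonzero 13th powers modulo 53 are just the four fourth roots of
  -- unity ±1, ±23. The residue 46 is a simple root of `exG₁`; 38 plays the same role for `exG₂`.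
  have hpow : ∀ c : ZMod 53, c ^ 13 ≠ (46 : ℤ) := by decide
  have : Fact (Nat.Prime 53) := ⟨by norm_num⟩
  refine irreducible_expand_of_simple_root (q := 53) irreducible_exG₁ (by rw [natDegree_exG₁]; simp)
    (by norm_num) 46 ?_ ?_ hpow
  · norm_num [exG₁]
  · norm_num [exG₁]

lemma irreducible_expand_thirteen_exG₂ : Irreducible (expand ℤ 13 exG₂) := by
  have hpow : ∀ c : ZMod 53, c ^ 13 ≠ (38 : ℤ) := by decide
  have : Fact (Nat.Prime 53) := ⟨by norm_num⟩
  refine irreducible_expand_of_simple_root (q := 53) irreducible_exG₂ (by rw [natDegree_exG₂]; simp)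
    (by norm_num) 38 ?_ ?_ hpow
  · norm_num [exG₂]
  · norm_num [exG₂]

lemma isSuitable_thirteen : IsSuitable exG₁ exG₂ 13 := by
  refine ⟨by norm_num, ?_, irreducible_expand_thirteen_exG₁, irreducible_expand_thirteen_exG₂⟩
  have h : (exG₁ * exG₂).natDegree < 13 := natDegree_exF.trans_lt (by norm_num)
  rw [height_mul_expand h, sq]

/-! ### The iterated product -/

/-- Splitting off the factor i = 0 keeps the left factor of degree 12, so k > 12 suffices for every
m in `height_mul_expand`. -/
lemma longProduct_succ (k m : ℕ) : longProduct k (m + 1) = exF * expand ℤ k (longProduct k m) := by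
  rw [longProduct, Finset.prod_range_succ', pow_zero, expand_one, mul_comm, longProduct, map_prod]
  simp_rw [expand_expand, pow_succ']

lemma height_longProduct {k : ℕ} (hk : 12 < k) (m : ℕ) : height (longProduct k m) = 1 := by
  induction m with
  | zero => rw [longProduct, Finset.prod_range_zero, height, ← C_1, supNorm_C, norm_one]
  | succ m ih =>
    rw [longProduct_succ, height_mul_expand (by rwa [natDegree_exF]), ih, height_exF, one_mul]

lemma prod_longFactors (k m : ℕ) : (longFactors k m).prod = longProduct k m := by
  rw [longFactors, Multiset.prod_add, longProduct]
  simp only [exF, map_mul, Finset.prod_mul_distrib]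
  rfl

lemma card_longFactors (k m : ℕ) : Multiset.card (longFactors k m) = 2 * m := by
  simp [longFactors, two_mul]

lemma mem_longFactors {k m : ℕ} {g : ℤ[X]} : g ∈ longFactors k m ↔
    (∃ i < m, expand ℤ (k ^ i) exG₁ = g) ∨ ∃ i < m, expand ℤ (k ^ i) exG₂ = g := by
  simp [longFactors]

lemma not_associated_expand {g h : ℤ[X]} (hg : g.natDegree = 6) (hh : h.natDegree = 6) {k : ℕ}
    (hk : 1 < k) {i j : ℕ} (hij : i ≠ j) :
    ¬ Associated (expand ℤ (k ^ i) g) (expand ℤ (k ^ j) h) := by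
  intro ha
  have := natDegree_eq_of_degree_eq (degree_eq_degree_of_associated ha)
  rw [natDegree_expand, natDegree_expand, hg, hh] at this
  exact hij (Nat.pow_right_injective hk (by simpa using this))

lemma not_associated_expand_exG {k : ℕ} (hk : 1 < k) (i j : ℕ) :
    ¬ Associated (expand ℤ (k ^ i) exG₁) (expand ℤ (k ^ j) exG₂) := by
  rcases eq_or_ne i j with rfl | hij
  · intro ha
    have hpos : 0 < k ^ i := pow_pos (by omega) i
    have he := eq_of_monic_of_associated ((monic_expand_iff hpos).2 monic_exG₁)
      ((monic_expand_iff hpos).2 monic_exG₂) ha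
    -- The linear coefficients are 2 and -1.
    have := congrArg (coeff · 1) ((expand_inj hpos).1 he)
    simp [exG₁, exG₂, coeff_one, coeff_X, coeff_X_pow] at this
  · exact not_associated_expand natDegree_exG₁ natDegree_exG₂ hk hij

lemma pairwise_longFactors {k : ℕ} (hk : 1 < k) (m : ℕ) :
    (longFactors k m).Pairwise fun a b => ¬ Associated a b := by
  refine ⟨(List.range m).map (fun i => expand ℤ (k ^ i) exG₁) ++
    (List.range m).map (fun i => expand ℤ (k ^ i) exG₂), rfl, ?_⟩
  rw [List.pairwise_append, List.pairwise_map, List.pairwise_map]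
  refine ⟨List.pairwise_lt_range.imp fun h =>
    not_associated_expand natDegree_exG₁ natDegree_exG₁ hk h.ne, List.pairwise_lt_range.imp fun h =>
    not_associated_expand natDegree_exG₂ natDegree_exG₂ hk h.ne, fun a ha b hb => ?_⟩
  obtain ⟨i, -, rfl⟩ := List.mem_map.1 ha
  obtain ⟨j, -, rfl⟩ := List.mem_map.1 hb
  exact not_associated_expand_exG hk i j

lemma height_of_mem_longFactors {k m : ℕ} (hk : 0 < k) {g : ℤ[X]} (hg : g ∈ longFactors k m) :
    height g = 2 := by
  rcases mem_longFactors.1 hg with ⟨i, -, rfl⟩ | ⟨i, -, rfl⟩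
  · rw [height_expand (pow_pos hk i), height_exG₁]
  · rw [height_expand (pow_pos hk i), height_exG₂]

lemma isLongExample_of_isSuitable {k : ℕ} (hk : k.Prime) (hk12 : 12 < k)
    (hs : IsSuitable exG₁ exG₂ k) (m : ℕ) :
    IsLongExample m (longProduct k m) (longFactors k m) := by
  refine ⟨height_longProduct hk12 m, ⟨prod_longFactors k m, fun g hg => ?_⟩, card_longFactors k m,
    pairwise_longFactors hk.one_lt m, fun g hg => height_of_mem_longFactors hk.pos hg⟩
  rcases mem_longFactors.1 hg with ⟨i, -, rfl⟩ | ⟨i, -, rfl⟩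
  · exact irreducible_expand_pow irreducible_exG₁ (by rw [natDegree_exG₁]; simp) hk (by omega)
      hs.2.2.1 i
  · exact irreducible_expand_pow irreducible_exG₂ (by rw [natDegree_exG₂]; simp) hk (by omega)
      hs.2.2.2 i

lemma IsLongExample.one_lt_ratio {m : ℕ} {p : ℤ[X]} {s : Multiset ℤ[X]} (h : IsLongExample m p s)
    (hm : 0 < m) : 1 < ratio s := by
  obtain ⟨hp, ⟨rfl, hi⟩, hc, -, hs⟩ := h
  refine LongFactorization.one_lt_ratio ?_ ?_ fun g hg => ?_
  · rintro rfl
    simp at hc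
    omega
  · exact Multiset.prod_ne_zero fun h0 => not_irreducible_zero (hi 0 h0)
  · rw [hp, hs g hg]
    norm_num

end LongFactorization

open LongFactorization in
theorem mainTheorem5 :
    -- one step of the construction, from any suitable short irreducible factorization
    (∀ f g₁ g₂ : ℤ[X], f = g₁ * g₂ → Irreducible g₁ → Irreducible g₂ →
      height f ^ 2 < min (height g₁) (height g₂) →
        (∀ k : ℕ, f.natDegree < k → height (f * expand ℤ k f) = height f ^ 2) ∧
        (¬ IsCyclotomic g₁ → ¬ IsCyclotomic g₂ →
          {k : ℕ | k.Prime ∧ ¬ IsSuitable g₁ g₂ k}.Finite) ∧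
        (∀ k : ℕ, IsSuitable g₁ g₂ k →
          IsIrreducibleFactorization (f * expand ℤ k f)
            {g₁, g₂, expand ℤ k g₁, expand ℤ k g₂} ∧
          1 < ratio {g₁, g₂, expand ℤ k g₁, expand ℤ k g₂})) ∧
    -- the explicit example
    (height exF = 1 ∧ Irreducible exG₁ ∧ Irreducible exG₂ ∧
      height exG₁ = 2 ∧ height exG₂ = 2 ∧ exF.natDegree = 12) ∧
    -- almost all primes, and `13` in particular, are suitable for it
    {k : ℕ | k.Prime ∧ ¬ IsSuitable exG₁ exG₂ k}.Finite ∧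
    IsSuitable exG₁ exG₂ 13 ∧
    -- the iterated construction
    (∀ k : ℕ, k.Prime → 12 < k → IsSuitable exG₁ exG₂ k → ∀ m : ℕ, 0 < m →
      IsLongExample m (longProduct k m) (longFactors k m) ∧ 1 < ratio (longFactors k m)) ∧
    -- consequently, every positive even number of factors occurs
    (∀ m : ℕ, 0 < m → ∃ (p : ℤ[X]) (s : Multiset ℤ[X]),
      IsLongExample m p s ∧ 1 < ratio s) := by
  have hlt : height (exG₁ * exG₂) ^ 2 < min (height exG₁) (height exG₂) := by
    have hF : height (exG₁ * exG₂) = 1 := height_exF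
    rw [hF, height_exG₁, height_exG₂]
    norm_num
  refine ⟨?_, ⟨height_exF, irreducible_exG₁, irreducible_exG₂, height_exG₁, height_exG₂,
    natDegree_exF⟩, finite_prime_not_isSuitable irreducible_exG₁ irreducible_exG₂ hlt
    not_isCyclotomic_exG₁ not_isCyclotomic_exG₂, isSuitable_thirteen, ?_, ?_⟩
  · rintro f g₁ g₂ rfl h₁ h₂ h
    exact ⟨fun k hk => by rw [height_mul_expand hk, sq],
      finite_prime_not_isSuitable h₁ h₂ h, fun k hk =>
      ⟨isIrreducibleFactorization_of_isSuitable h₁ h₂ hk, one_lt_ratio_of_isSuitable h₁ h₂ hk h⟩⟩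
  · intro k hk hk12 hs m hm
    have := isLongExample_of_isSuitable hk hk12 hs m
    exact ⟨this, this.one_lt_ratio hm⟩
  · intro m hm
    have := isLongExample_of_isSuitable (by norm_num) (by norm_num) isSuitable_thirteen m
    exact ⟨_, _, this, this.one_lt_ratio hm⟩
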